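/- Let $\delta$ be a random sign with $0<P(\delta=1)<1$, and let $(T_i^+)_{i\ge 1}$ and $(T_i^-)_{i\ge 1}$ be two sequences of iid random variables such that $\delta$, $(T_i^+)$ and $(T_i^-)$ are mutually independent. Assume that the switching times $T_+:=T_1^+$ and $T_-:=T_1^-$ are non-negative, absolutely continuous (so that they have no atom at zero) and have finite expectations $\mu_+$ and $\mu_-$. The non-stationary switch process $D(t)$, $t\ge 0$, starts at the value $\delta$ and alternates between the values $1$ and $-1$: if $\delta=1$ it equals $1$ on $[0,T_1^+)$, $-1$ on $[T_1^+,T_1^++T_1^-)$, $1$ on the next interval, of length $T_2^+$, and so on; if $\delta=-1$ it equals $-1$ on $[0,T_1^-)$, $1$ on $[T_1^-,T_1^-+T_1^+)$, and so on. Let $E_+(t)=E(D(t)\mid\delta=1)$ and $E_-(t)=E(D(t)\mid\delta=-1)$ be the expected value functions, and put $$\alpha=\frac{\mu_-}{\mu_++\mu_-},\qquad \beta=\frac{\mu_+}{\mu_++\mu_-}.$$ Then $E_+$ and $E_-$ are differentiable at almost every $t>0$, and the following conditions are equivalent: i) $-E_+'(t)\ge 0$ and $E_-'(t)\ge 0$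 at every $t>0$ at which the respective derivative exists; ii) $T_+$ and $T_-$ have the stochastic representations $$T_+\stackrel{d}{=}X+\sum_{k=1}^{\nu_\alpha-1}Y_k,\qquad T_-\stackrel{d}{=}Y+\sum_{k=1}^{\nu_\beta-1}X_k,$$ where $\nu_\alpha,\nu_\beta$ are geometrically distributed, $P(\nu_p=k)=(1-p)^{k-1}p$ for $k=1,2,\dots$, with the parameters $p=\alpha$ and $p=\beta$, where $X,X_1,X_2,\dots$ are iid random variables, $Y,Y_1,Y_2,\dots$ are iid random variables, and where $\nu_\alpha$, $\nu_\beta$, $(X,X_1,X_2,\dots)$ and $(Y,Y_1,Y_2,\dots)$ are mutually independent. Moreover, in every representation as in ii), the variables $X,X_k$ and $Y,Y_k$ are concentrated on $(0,\infty)$ and have there the densities $$f_X(t)=-\frac{1}{2\alpha}E_+'(t),\qquad f_Y(t)=\frac{1}{2\beta}E_-'(t).$$ -/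

import Mathlib

open MeasureTheory ProbabilityTheory Set

namespace SwitchProcess

variable {Ω : Type*}

/-- The length of the `n`-th interval (`n = 0, 1, 2, …`) after the origin. The process has the
sign `δ * (-1) ^ n` there, and the `n`-th interval is number `n / 2` among those with its sign. -/
def holding (δ : Ω → ℤ) (Tp Tm : ℕ → Ω → ℝ) (n : ℕ) (ω : Ω) : ℝ :=
  if δ ω * (-1) ^ n = 1 then Tp (n / 2) ω else Tm (n / 2) ω

/-- The time of the `n`-th switch, the switch number `0` being the one at the origin. -/
def switchTime (δ : Ω → ℤ) (Tp Tm : ℕ → Ω → ℝ) (n : ℕ) (ω : Ω) : ℝ :=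
  ∑ k ∈ Finset.range n, holding δ Tp Tm k ω

/-- The number of switches in `(0, t]`. -/
noncomputable def switchCount (δ : Ω → ℤ) (Tp Tm : ℕ → Ω → ℝ) (t : ℝ) (ω : Ω) : ℕ :=
  Set.ncard {n : ℕ | 1 ≤ n ∧ switchTime δ Tp Tm n ω ≤ t}

/-- The non-stationary switch process `D(t)`, `t ≥ 0`: it starts at `δ` and changes sign at each
switch, so it is `δ * (-1) ^ n` from the `n`-th switch until just before the next one. -/
noncomputable def process (δ : Ω → ℤ) (Tp Tm : ℕ → Ω → ℝ) (t : ℝ) (ω : Ω) : ℝ :=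
  (δ ω : ℝ) * (-1) ^ switchCount δ Tp Tm t ω

/-- The expected value function `E_s(t) = E(D(t) | δ = s)`, for `s = 1` or `s = -1`. -/
noncomputable def expectedValue [MeasurableSpace Ω] (P : Measure Ω) (δ : Ω → ℤ)
    (Tp Tm : ℕ → Ω → ℝ) (s : ℤ) (t : ℝ) : ℝ :=
  ∫ ω, process δ Tp Tm t ω ∂(ProbabilityTheory.cond P {ω | δ ω = s})

/-- The data of a non-stationary switch process: a random initial sign `δ`, and two sequences of
iid switching times, the sign and the two sequences being mutually independent. The switching
times are non-negative, absolutely continuous (so that zero is not an atom) and have finite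
expectation. -/
structure IsSwitchData [MeasurableSpace Ω] (P : Measure Ω) (δ : Ω → ℤ)
    (Tp Tm : ℕ → Ω → ℝ) : Prop where
  measurable_sign : Measurable δ
  sign_eq : ∀ ω, δ ω = 1 ∨ δ ω = -1
  measurable_plus : ∀ i, Measurable (Tp i)
  measurable_minus : ∀ i, Measurable (Tm i)
  identDistrib_plus : ∀ i, IdentDistrib (Tp i) (Tp 0) P P
  identDistrib_minus : ∀ i, IdentDistrib (Tm i) (Tm 0) P P
  indep_plus : iIndepFun Tp P
  indep_minus : iIndepFun Tm P
  indep_plus_minus : IndepFun (fun ω i => Tp i ω) (fun ω i => Tm i ω) P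
  indep_sign : IndepFun δ (fun ω => (fun i => Tp i ω, fun i => Tm i ω)) P
  nonneg_plus : ∀ᵐ ω ∂P, 0 ≤ Tp 0 ω
  nonneg_minus : ∀ᵐ ω ∂P, 0 ≤ Tm 0 ω
  absolutelyContinuous_plus : P.map (Tp 0) ≪ volume
  absolutelyContinuous_minus : P.map (Tm 0) ≪ volume
  integrable_plus : Integrable (Tp 0) P
  integrable_minus : Integrable (Tm 0) P

/-- `ν` is geometric with parameter `p` on `{1, 2, …}`: `P(ν = k) = (1 - p) ^ (k - 1) * p`. -/
def IsGeometric [MeasurableSpace Ω] (P : Measure Ω) (ν : Ω → ℕ) (p : ℝ) : Prop :=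
  Measurable ν ∧ ∀ k : ℕ, 1 ≤ k → P {ω | ν ω = k} = ENNReal.ofReal ((1 - p) ^ (k - 1) * p)

/-- The random variables `X = X 0, X 1, X 2, …` are iid, so are `Y = Y 0, Y 1, Y 2, …`, the
numbers `νa` and `νb` are geometric with parameters `α` and `β`, all of these are mutually
independent, and `X + ∑_{k=1}^{νa-1} Y k` and `Y + ∑_{k=1}^{νb-1} X k` are distributed as `Tp`
and `Tm`, respectively. -/
structure IsRepresentation {Ω' : Type*} [MeasurableSpace Ω] [MeasurableSpace Ω']
    (P : Measure Ω) (Tp Tm : Ω → ℝ) (α β : ℝ)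
    (Q : Measure Ω') (X Y : ℕ → Ω' → ℝ) (νa νb : Ω' → ℕ) : Prop where
  measurable_X : ∀ k, Measurable (X k)
  measurable_Y : ∀ k, Measurable (Y k)
  identDistrib_X : ∀ k, IdentDistrib (X k) (X 0) Q Q
  identDistrib_Y : ∀ k, IdentDistrib (Y k) (Y 0) Q Q
  geometric_a : IsGeometric Q νa α
  geometric_b : IsGeometric Q νb β
  indep_X : iIndepFun X Q
  indep_Y : iIndepFun Y Q
  indep_X_Y : IndepFun (fun ω k => X k ω) (fun ω k => Y k ω) Q
  indep_a_b : IndepFun νa νb Q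
  indep_ab_XY : IndepFun (fun ω => (νa ω, νb ω)) (fun ω => (fun k => X k ω, fun k => Y k ω)) Q
  plus : IdentDistrib Tp (fun ω => X 0 ω + ∑ k ∈ Finset.Icc 1 (νa ω - 1), Y k ω) P Q
  minus : IdentDistrib Tm (fun ω => Y 0 ω + ∑ k ∈ Finset.Icc 1 (νb ω - 1), X k ω) P Q

end SwitchProcess

open SwitchProcess

/-!
Let `A` and `B` be the laws of the switching times `T_+` and `T_-`. Everything is expressed by
convolutions of positive measures on the line, which replace the usual Laplace transforms.

The process started at `1` changes sign at its switches, and so `E_+(t)` is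
`1 - 2 O(-∞, t] + 2 V(-∞, t]`, where `O = ∑ₖ A^{∗(k+1)} ∗ B^{∗k}` and `V = ∑ₖ (A ∗ B)^{∗(k+1)}`
count the expected odd-numbered and even-numbered switches (`expectedValue_one`); exchanging the signs
leads to `E_-`, with `O' = ∑ₖ B^{∗(k+1)} ∗ A^{∗k}` in place of `O` and the same `V`. These measures
are absolutely continuous and finite on left half-lines, so that Lebesgue's differentiation theorem
gives the derivatives almost everywhere, and the sign conditions say that `V ≤ O` and `V ≤ O'`, that
is, `O = ρ + V` and `O' = σ + V` with positive measures `ρ` and `σ`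
(`exists_eq_add_of_deriv_nonpos`).

This decomposition is equivalent to the pair of renewal equations `A = ρ + A ∗ σ`, `B = σ + B ∗ ρ`
(`oddRenewal_eq_of_equations`, `eq_add_conv_of_oddRenewal_eq`), by algebra with convolutions and
cancellation of locally finite measures. On the other hand, `A = ρ + A ∗ σ` means that
`A = ∑ₖ ρ ∗ σ^{∗k}` (`eq_conv_renewal`), which is the law of a geometric random sum with
`ρ = α P_X` and `σ = β P_Y` (`map_geometric_sum`). That `ρ` and `σ` have the masses `α` and `β` is
found by comparing first moments in the two equations (`measure_univ_of_equations`). The densities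
of `X` and `Y` are read off from `E_+(t) = 1 - 2 ρ(-∞, t]` and `E_-(t) = -1 + 2 σ(-∞, t]`.
-/

namespace SwitchProcess

open scoped ENNReal

/-! ### Convolution powers and renewal measures -/

/-- The `n`-fold convolution power of a measure on the line. -/
noncomputable def convPow (μ : Measure ℝ) : ℕ → Measure ℝ
  | 0 => Measure.dirac 0
  | n + 1 => convPow μ n ∗ μ

instance sFinite_convPow (μ : Measure ℝ) [SFinite μ] (n : ℕ) : SFinite (convPow μ n) := by
  induction n with
  | zero => exact inferInstanceAs (SFinite (Measure.dirac 0))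
  | succ n ih => exact inferInstanceAs (SFinite (convPow μ n ∗ μ))

/-- The renewal measure `∑ₙ μ^{∗n}`. -/
noncomputable def renewal (μ : Measure ℝ) : Measure ℝ := Measure.sum (convPow μ)

instance sFinite_renewal (μ : Measure ℝ) [SFinite μ] : SFinite (renewal μ) :=
  inferInstanceAs (SFinite (Measure.sum (convPow μ)))

lemma conv_sum (μ : Measure ℝ) (m : ℕ → Measure ℝ) [∀ n, SFinite (m n)] :
    μ ∗ Measure.sum m = Measure.sum fun n => μ ∗ m n := by
  rw [Measure.conv, Measure.prod_sum_right, Measure.map_sum (by fun_prop)]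
  rfl

lemma conv_left_comm (μ ν ρ : Measure ℝ) [SFinite μ] [SFinite ν] [SFinite ρ] :
    μ ∗ (ν ∗ ρ) = ν ∗ (μ ∗ ρ) := by
  rw [← Measure.conv_assoc, Measure.conv_comm μ ν, Measure.conv_assoc]

lemma convPow_conv (μ ν : Measure ℝ) [SFinite μ] [SFinite ν] (n : ℕ) :
    convPow (μ ∗ ν) n = convPow μ n ∗ convPow ν n := by
  induction n with
  | zero => simp [convPow]
  | succ n ih =>
    simp only [convPow, ih]
    rw [Measure.conv_assoc, Measure.conv_assoc, conv_left_comm (convPow ν n)]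

lemma convPow_smul (c : ℝ≥0∞) (μ : Measure ℝ) [SFinite μ] (n : ℕ) :
    convPow (c • μ) n = c ^ n • convPow μ n := by
  induction n with
  | zero => simp [convPow]
  | succ n ih =>
    simp only [convPow, ih]
    rw [Measure.conv_smul_left, Measure.conv_smul_right, smul_smul, pow_succ]

/-- The renewal equation. -/
lemma renewal_eq (μ : Measure ℝ) [SFinite μ] :
    renewal μ = Measure.dirac 0 + μ ∗ renewal μ := by
  have h : μ ∗ renewal μ = Measure.sum fun n => convPow μ (n + 1) := by
    rw [renewal, conv_sum]
    congr 1
    ext1 n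
    rw [Measure.conv_comm]
    rfl
  rw [h]
  ext s hs
  rw [renewal, Measure.add_apply, Measure.sum_apply _ hs, Measure.sum_apply _ hs,
    tsum_eq_zero_add' ENNReal.summable]
  rfl

lemma conv_univ (μ ν : Measure ℝ) [SFinite ν] :
    (μ ∗ ν) univ = μ univ * ν univ := by
  rw [Measure.conv, Measure.map_apply (by fun_prop) MeasurableSet.univ, preimage_univ,
    ← univ_prod_univ, Measure.prod_prod]

lemma convPow_univ (μ : Measure ℝ) [SFinite μ] (n : ℕ) :
    convPow μ n univ = μ univ ^ n := by
  induction n with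
  | zero => simp [convPow]
  | succ n ih => rw [convPow, conv_univ, ih, pow_succ]

lemma eq_sum_add_conv_convPow {A ρ σ : Measure ℝ} [SFinite A] [SFinite ρ] [SFinite σ]
    (h : A = ρ + A ∗ σ) (s : Set ℝ) (n : ℕ) :
    A s = ∑ k ∈ Finset.range n, (ρ ∗ convPow σ k) s + (A ∗ convPow σ n) s := by
  induction n with
  | zero => simp [convPow]
  | succ n ih =>
    have h2 : A ∗ convPow σ n = ρ ∗ convPow σ n + A ∗ convPow σ (n + 1) := by
      conv_lhs => rw [h]
      rw [Measure.add_conv, Measure.conv_assoc, Measure.conv_comm σ]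
      rfl
    rw [Finset.sum_range_succ, add_assoc, ← Measure.add_apply, ← h2, ih]

/-- The only finite solution `A` of `A = ρ + A ∗ σ` with a defective `σ` is `ρ ∗ ∑ₙ σ^{∗n}`,
because the `n`-fold iterate leaves the remainder `A ∗ σ^{∗n}`, of vanishing mass. -/
lemma eq_conv_renewal {A ρ σ : Measure ℝ} [IsFiniteMeasure A] [SFinite ρ] [SFinite σ]
    (hσ : σ univ < 1) (h : A = ρ + A ∗ σ) : A = ρ ∗ renewal σ := by
  rw [renewal, conv_sum]
  ext s hs
  rw [Measure.sum_apply _ hs]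
  have hlim : Filter.Tendsto (fun n => (A ∗ convPow σ n) s) Filter.atTop (nhds 0) := by
    have h1 : Filter.Tendsto (fun n => A univ * σ univ ^ n) Filter.atTop (nhds (A univ * 0)) :=
      ENNReal.Tendsto.const_mul (ENNReal.tendsto_pow_atTop_nhds_zero_of_lt_one hσ)
        (Or.inr (measure_ne_top A univ))
    rw [mul_zero] at h1
    refine tendsto_of_tendsto_of_tendsto_of_le_of_le tendsto_const_nhds h1 (fun _ => zero_le)
      fun n => ?_
    calc (A ∗ convPow σ n) s ≤ (A ∗ convPow σ n) univ := measure_mono (subset_univ _)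
      _ = _ := by rw [conv_univ, convPow_univ]
  have h2 := (ENNReal.tendsto_nat_tsum fun k => (ρ ∗ convPow σ k) s).add hlim
  rw [add_zero] at h2
  refine tendsto_nhds_unique ?_ h2
  simp_rw [← eq_sum_add_conv_convPow h s]
  exact tendsto_const_nhds

/-! ### Local finiteness -/

/-- The Laplace transform at `1`. Its finiteness bounds the mass of left half-lines, also for the
infinite renewal measures. -/
noncomputable def laplaceOne (μ : Measure ℝ) : ℝ≥0∞ := ∫⁻ x, ENNReal.ofReal (Real.exp (-x)) ∂μ

lemma laplaceOne_conv (μ ν : Measure ℝ) [SFinite ν] :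
    laplaceOne (μ ∗ ν) = laplaceOne μ * laplaceOne ν := by
  rw [laplaceOne, Measure.lintegral_conv (by fun_prop), laplaceOne, laplaceOne,
    ← lintegral_mul_const _ (by fun_prop)]
  refine lintegral_congr fun x => ?_
  rw [← lintegral_const_mul _ (by fun_prop)]
  refine lintegral_congr fun y => ?_
  rw [neg_add, Real.exp_add, ENNReal.ofReal_mul (Real.exp_nonneg _)]

lemma laplaceOne_convPow (μ : Measure ℝ) [SFinite μ] (n : ℕ) :
    laplaceOne (convPow μ n) = laplaceOne μ ^ n := by
  induction n with
  | zero => simp [convPow, laplaceOne]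
  | succ n ih => rw [convPow, laplaceOne_conv, ih, pow_succ]

lemma laplaceOne_lt_one (μ : Measure ℝ) [IsProbabilityMeasure μ] (h : μ (Iic 0) = 0) :
    laplaceOne μ < 1 := by
  have h0 : ∀ᵐ x ∂μ, (0 : ℝ) < x := by
    rw [ae_iff]
    simp only [not_lt]
    exact h
  have h1 : laplaceOne μ < ∫⁻ _, 1 ∂μ := by
    refine lintegral_strict_mono (IsProbabilityMeasure.ne_zero μ) (by fun_prop) ?_ ?_
    · refine ((lintegral_mono_ae (g := fun _ => 1) ?_).trans_lt (by simp)).ne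
      filter_upwards [h0] with x hx
      simpa using hx.le
    · filter_upwards [h0] with x hx
      simpa using hx
  simpa using h1

lemma measure_Iic_lt_top_of_laplaceOne {μ : Measure ℝ} (h : laplaceOne μ < ∞) (t : ℝ) :
    μ (Iic t) < ∞ := by
  have h1 : ENNReal.ofReal (Real.exp (-t)) * μ (Iic t) ≤ laplaceOne μ := by
    rw [← setLIntegral_const]
    refine (setLIntegral_mono (by fun_prop) fun x hx => ?_).trans (setLIntegral_le_lintegral _ _)
    exact ENNReal.ofReal_le_ofReal (Real.exp_le_exp.2 (neg_le_neg hx))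
  by_contra hcon
  rw [not_lt, top_le_iff] at hcon
  rw [hcon, ENNReal.mul_top (by simp [Real.exp_pos])] at h1
  exact absurd (h1.trans_lt h) (lt_irrefl _)

lemma laplaceOne_renewal_lt_top {μ : Measure ℝ} [SFinite μ] (h : laplaceOne μ < 1) :
    laplaceOne (renewal μ) < ∞ := by
  rw [laplaceOne, renewal, lintegral_sum_measure]
  change ∑' n, laplaceOne (convPow μ n) < ∞
  simp_rw [laplaceOne_convPow, ENNReal.tsum_geometric]
  exact ENNReal.inv_lt_top.2 (tsub_pos_of_lt h)

lemma conv_Iic_zero {μ ν : Measure ℝ} [SFinite ν] (hμ : μ (Iic 0) = 0) (hν : ν (Iio 0) = 0) :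
    (μ ∗ ν) (Iic 0) = 0 := by
  rw [Measure.conv, Measure.map_apply (by fun_prop) measurableSet_Iic]
  refine measure_mono_null (t := Iic 0 ×ˢ univ ∪ univ ×ˢ Iio 0) ?_ ?_
  · rintro ⟨x, y⟩ h
    simp only [mem_preimage, mem_Iic] at h
    by_cases hx : x ≤ 0
    · exact Or.inl ⟨hx, trivial⟩
    · exact Or.inr ⟨trivial, by simp only [mem_Iio]; linarith [not_le.1 hx]⟩
  · rw [measure_union_null_iff, Measure.prod_prod, Measure.prod_prod, hμ, hν]
    simp

lemma isLocallyFinite_of_Iic {μ : Measure ℝ} (h : ∀ t, μ (Iic t) < ∞) :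
    IsLocallyFiniteMeasure μ :=
  ⟨fun x => ⟨Iic (x + 1), Iic_mem_nhds (by linarith), h _⟩⟩

lemma laplaceOne_add (μ ν : Measure ℝ) : laplaceOne (μ + ν) = laplaceOne μ + laplaceOne ν :=
  lintegral_add_measure _ _ _

lemma locallyFinite_of_laplaceOne {μ : Measure ℝ} (h : laplaceOne μ < ∞) :
    IsLocallyFiniteMeasure μ :=
  isLocallyFinite_of_Iic (measure_Iic_lt_top_of_laplaceOne h)

/-! ### Laws of the switching times -/

/-- The time of the `n`-th switch of the process started at `1`, when `U` lists the switching times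
at `1` and `V` those at `-1`. -/
def altSum (U V : ℕ → ℝ) (n : ℕ) : ℝ :=
  ∑ i ∈ Finset.range ((n + 1) / 2), U i + ∑ i ∈ Finset.range (n / 2), V i

lemma altSum_succ (U V : ℕ → ℝ) (n : ℕ) :
    altSum U V (n + 1) = altSum U V n + if Even n then U (n / 2) else V (n / 2) := by
  unfold altSum
  rcases Nat.even_or_odd' n with ⟨k, rfl | rfl⟩
  · rw [show (2 * k + 1 + 1) / 2 = k + 1 by omega, show (2 * k + 1) / 2 = k by omega,
      show 2 * k / 2 = k by omega, Finset.sum_range_succ, if_pos (by simp)]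
    ring
  · rw [show (2 * k + 1 + 1 + 1) / 2 = k + 1 by omega, show (2 * k + 1 + 1) / 2 = k + 1 by omega,
      show (2 * k + 1) / 2 = k by omega, Finset.sum_range_succ V, if_neg (by simp)]
    ring

lemma switchTime_eq_altSum {Ω : Type*} {δ : Ω → ℤ} {Tp Tm : ℕ → Ω → ℝ} {ω : Ω}
    (h : δ ω = 1) (n : ℕ) :
    switchTime δ Tp Tm n ω = altSum (fun i => Tp i ω) (fun i => Tm i ω) n := by
  induction n with
  | zero => simp [switchTime, altSum]
  | succ n ih =>
    rw [altSum_succ, ← ih, switchTime, Finset.sum_range_succ, ← switchTime]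
    congr 1
    unfold holding
    rcases Nat.even_or_odd n with hn | hn
    · simp [h, hn.neg_one_pow, hn]
    · simp [h, hn.neg_one_pow, Nat.not_even_iff_odd.2 hn]

lemma process_swap {Ω : Type*} {δ : Ω → ℤ} {Tp Tm : ℕ → Ω → ℝ}
    (hs : ∀ ω, δ ω = 1 ∨ δ ω = -1) (t : ℝ) (ω : Ω) :
    process (fun ω => -δ ω) Tm Tp t ω = -process δ Tp Tm t ω := by
  have h1 : ∀ n, holding (fun ω => -δ ω) Tm Tp n ω = holding δ Tp Tm n ω := by
    intro n
    unfold holding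
    rcases hs ω with h | h <;> rcases neg_one_pow_eq_or ℤ n with h' | h' <;> simp [h, h']
  simp [process, switchCount, switchTime, h1]

section Laws

variable {Ω : Type*} [MeasurableSpace Ω] {P : Measure Ω}

lemma map_sum_range [IsProbabilityMeasure P] {X : ℕ → Ω → ℝ} (hm : ∀ i, Measurable (X i))
    (hid : ∀ i, IdentDistrib (X i) (X 0) P P) (hind : iIndepFun X P) (n : ℕ) :
    P.map (fun ω => ∑ i ∈ Finset.range n, X i ω) = convPow (P.map (X 0)) n := by
  induction n with
  | zero => simp [convPow]
  | succ n ih =>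
    have h := (hind.indepFun_sum_range_succ hm n).map_add_eq_map_conv_map
      (by fun_prop) (hm n)
    rw [(hid n).map_eq] at h
    have h2 : (∑ j ∈ Finset.range n, X j : Ω → ℝ) = fun ω => ∑ i ∈ Finset.range n, X i ω := by
      ext ω
      simp
    rw [h2, ih] at h
    rw [convPow, ← h]
    congr 1
    ext ω
    simp [Finset.sum_range_succ]

variable {δ : Ω → ℤ} {Tp Tm : ℕ → Ω → ℝ}

/-- Exchanging the two signs. -/
lemma IsSwitchData.swap (h : IsSwitchData P δ Tp Tm) :
    IsSwitchData P (fun ω => -δ ω) Tm Tp where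
  measurable_sign := h.measurable_sign.neg
  sign_eq ω := by rcases h.sign_eq ω with h | h <;> simp [h]
  measurable_plus := h.measurable_minus
  measurable_minus := h.measurable_plus
  identDistrib_plus := h.identDistrib_minus
  identDistrib_minus := h.identDistrib_plus
  indep_plus := h.indep_minus
  indep_minus := h.indep_plus
  indep_plus_minus := h.indep_plus_minus.symm
  indep_sign := h.indep_sign.comp (φ := fun z : ℤ => -z)
    (ψ := fun x : (ℕ → ℝ) × (ℕ → ℝ) => (x.2, x.1)) (by fun_prop) (by fun_prop)
  nonneg_plus := h.nonneg_minus
  nonneg_minus := h.nonneg_plus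
  absolutelyContinuous_plus := h.absolutelyContinuous_minus
  absolutelyContinuous_minus := h.absolutelyContinuous_plus
  integrable_plus := h.integrable_minus
  integrable_minus := h.integrable_plus

lemma expectedValue_swap (hs : ∀ ω, δ ω = 1 ∨ δ ω = -1) (t : ℝ) :
    expectedValue P δ Tp Tm (-1) t = -expectedValue P (fun ω => -δ ω) Tm Tp 1 t := by
  have h1 : {ω | -δ ω = 1} = {ω | δ ω = -1} := by
    ext ω
    simp only [mem_ofPred_eq]
    omega
  simp only [expectedValue, process_swap hs, integral_neg, neg_neg, h1]

lemma measure_Iic_zero_of_nonneg {T : Ω → ℝ} (hT : Measurable T) (h0 : ∀ᵐ ω ∂P, 0 ≤ T ω)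
    (hac : P.map T ≪ volume) : P.map T (Iic 0) = 0 := by
  have h1 : P.map T {0} = 0 := hac (by simp)
  have h2 : P.map T (Iio 0) = 0 := by
    rw [Measure.map_apply hT measurableSet_Iio]
    simp only [ae_iff, not_le] at h0
    exact h0
  rw [← Iio_union_right, measure_union_null_iff]
  exact ⟨h2, h1⟩

lemma map_altSum [IsProbabilityMeasure P] (h : IsSwitchData P δ Tp Tm) (n : ℕ) :
    P.map (fun ω => altSum (fun i => Tp i ω) (fun i => Tm i ω) n) =
      convPow (P.map (Tp 0)) ((n + 1) / 2) ∗ convPow (P.map (Tm 0)) (n / 2) := by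
  rw [← map_sum_range h.measurable_plus h.identDistrib_plus h.indep_plus,
    ← map_sum_range h.measurable_minus h.identDistrib_minus h.indep_minus]
  have hp := h.measurable_plus
  have hm := h.measurable_minus
  refine IndepFun.map_add_eq_map_conv_map (Finset.measurable_sum _ fun i _ => hp i)
    (Finset.measurable_sum _ fun i _ => hm i) ?_
  exact h.indep_plus_minus.comp (φ := fun x : ℕ → ℝ => ∑ i ∈ Finset.range ((n + 1) / 2), x i)
    (ψ := fun x : ℕ → ℝ => ∑ i ∈ Finset.range (n / 2), x i) (by fun_prop) (by fun_prop)

/-- Conditioning on the initial sign does not change the law of the switch times. -/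
lemma map_altSum_cond [IsProbabilityMeasure P] (h : IsSwitchData P δ Tp Tm)
    (hpos : 0 < P {ω | δ ω = 1}) (n : ℕ) :
    (ProbabilityTheory.cond P {ω | δ ω = 1}).map
      (fun ω => altSum (fun i => Tp i ω) (fun i => Tm i ω) n) =
      convPow (P.map (Tp 0)) ((n + 1) / 2) ∗ convPow (P.map (Tm 0)) (n / 2) := by
  rw [← map_altSum h]
  have hp := h.measurable_plus
  have hm := h.measurable_minus
  have hmeas : Measurable fun ω => altSum (fun i => Tp i ω) (fun i => Tm i ω) n := by
    unfold altSum
    fun_prop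
  have hδ : MeasurableSet {ω | δ ω = 1} := h.measurable_sign (measurableSet_singleton 1)
  ext s hs
  rw [Measure.map_apply hmeas hs, Measure.map_apply hmeas hs, cond_apply hδ]
  have h1 : IndepFun δ (fun ω => altSum (fun i => Tp i ω) (fun i => Tm i ω) n) P :=
    h.indep_sign.comp (φ := id) (ψ := fun x : (ℕ → ℝ) × (ℕ → ℝ) => altSum x.1 x.2 n)
      measurable_id (by unfold altSum; fun_prop)
  have h2 := h1.measure_inter_preimage_eq_mul {1} s (measurableSet_singleton 1) hs
  change P ({ω | δ ω = 1} ∩ _) = P {ω | δ ω = 1} * _ at h2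
  rw [h2, ← mul_assoc, ENNReal.inv_mul_cancel hpos.ne' (measure_ne_top _ _), one_mul]

end Laws

/-! ### The expected value function through renewal measures -/

/-- The measure `∑ₖ A^{∗(k+1)} ∗ B^{∗k}`. Its mass on `(-∞, t]` is the expected number of
odd-numbered switches up to time `t`, for the process started at `1` whose switching times have the
laws `A` and `B`. -/
noncomputable def oddRenewal (A B : Measure ℝ) : Measure ℝ := A ∗ renewal (A ∗ B)

/-- The measure `∑ₖ (A ∗ B)^{∗(k+1)}`. Its mass on `(-∞, t]` is the expected number of
even-numbered switches up to time `t`, the switch number `0` at the origin not being counted. -/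
noncomputable def evenRenewal (A B : Measure ℝ) : Measure ℝ := (A ∗ B) ∗ renewal (A ∗ B)

instance (A B : Measure ℝ) [SFinite A] [SFinite B] : SFinite (oddRenewal A B) :=
  inferInstanceAs (SFinite (A ∗ renewal (A ∗ B)))

instance (A B : Measure ℝ) [SFinite A] [SFinite B] : SFinite (evenRenewal A B) :=
  inferInstanceAs (SFinite ((A ∗ B) ∗ renewal (A ∗ B)))

lemma oddRenewal_eq_sum (A B : Measure ℝ) [SFinite A] [SFinite B] :
    oddRenewal A B = Measure.sum fun k => convPow A (k + 1) ∗ convPow B k := by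
  rw [oddRenewal, renewal, conv_sum]
  congr 1
  ext1 k
  rw [convPow_conv, ← Measure.conv_assoc, Measure.conv_comm A]
  rfl

lemma evenRenewal_eq_sum (A B : Measure ℝ) [SFinite A] [SFinite B] :
    evenRenewal A B = Measure.sum fun k => convPow A (k + 1) ∗ convPow B (k + 1) := by
  rw [evenRenewal, renewal, conv_sum]
  congr 1
  ext1 k
  rw [← convPow_conv, Measure.conv_comm]
  rfl

lemma evenRenewal_comm (A B : Measure ℝ) [SFinite A] [SFinite B] :
    evenRenewal A B = evenRenewal B A := by
  rw [evenRenewal, evenRenewal, Measure.conv_comm A B]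

/-- If `N` is the last index with `S N ≤ t`, then the parity of `N` is read off from the numbers
of odd and of positive even indices up to `N`. -/
lemma neg_one_pow_ncard_eq {S : ℕ → ℝ} (hS : Monotone S) {t : ℝ} (hfin : ∃ n, t < S n) :
    (-1 : ℝ) ^ Set.ncard {n : ℕ | 1 ≤ n ∧ S n ≤ t} =
      1 - 2 * (∑' k, (Iic t).indicator (1 : ℝ → ℝ≥0∞) (S (2 * k + 1))).toReal
        + 2 * (∑' k, (Iic t).indicator (1 : ℝ → ℝ≥0∞) (S (2 * k + 2))).toReal := by
  classical
  obtain ⟨N, hN⟩ : ∃ N, ∀ n, 1 ≤ n → (S n ≤ t ↔ n ≤ N) := by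
    refine ⟨Nat.find hfin - 1, fun n hn => ?_⟩
    have h1 := Nat.find_spec hfin
    constructor
    · intro h
      by_contra hcon
      exact absurd (h1.trans_le (hS (show Nat.find hfin ≤ n by omega))) (not_lt.2 h)
    · intro h
      exact not_lt.1 (Nat.find_min hfin (show n < Nat.find hfin by omega))
  have hset : {n : ℕ | 1 ≤ n ∧ S n ≤ t} = (Finset.Icc 1 N : Set ℕ) := by
    ext n
    simp only [mem_ofPred_eq, Finset.coe_Icc, mem_Icc]
    exact and_congr_right fun hn => hN n hn
  have hsum : ∀ (f : ℕ → ℕ) (m : ℕ), (∀ k, 1 ≤ f k) → (∀ k, f k ≤ N ↔ k < m) →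
      (∑' k, (Iic t).indicator (1 : ℝ → ℝ≥0∞) (S (f k))).toReal = m := by
    intro f m h1 h2
    rw [tsum_eq_sum (s := Finset.range m)]
    · rw [Finset.sum_congr rfl (g := fun _ => 1)]
      · simp
      · intro k hk
        rw [indicator_of_mem]
        · rfl
        · exact (hN _ (h1 k)).2 ((h2 k).2 (Finset.mem_range.1 hk))
    · intro k hk
      refine indicator_of_notMem (fun h => hk ?_) _
      exact Finset.mem_range.2 ((h2 k).1 ((hN _ (h1 k)).1 h))
  rw [hset, Set.ncard_coe_finset, Nat.card_Icc, Nat.add_sub_cancel,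
    hsum (fun k => 2 * k + 1) ((N + 1) / 2) (by intro k; omega) (by intro k; omega),
    hsum (fun k => 2 * k + 2) (N / 2) (by intro k; omega) (by intro k; omega)]
  rcases Nat.even_or_odd' N with ⟨k, rfl | rfl⟩
  · rw [show (2 * k + 1) / 2 = k by omega, show 2 * k / 2 = k by omega]
    simp
  · rw [show (2 * k + 1 + 1) / 2 = k + 1 by omega, show (2 * k + 1) / 2 = k by omega,
      pow_succ, pow_mul]
    push_cast
    norm_num
    ring

lemma laplaceOne_renewal_conv_lt_top {A B : Measure ℝ} [IsProbabilityMeasure A]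
    [IsProbabilityMeasure B] (hA : A (Iic 0) = 0) (hB : B (Iic 0) = 0) :
    laplaceOne (renewal (A ∗ B)) < ∞ :=
  laplaceOne_renewal_lt_top (laplaceOne_lt_one _
    (conv_Iic_zero hA (measure_mono_null Iio_subset_Iic_self hB)))

lemma laplaceOne_oddRenewal_lt_top {A B : Measure ℝ} [IsProbabilityMeasure A]
    [IsProbabilityMeasure B] (hA : A (Iic 0) = 0) (hB : B (Iic 0) = 0) :
    laplaceOne (oddRenewal A B) < ∞ := by
  rw [oddRenewal, laplaceOne_conv]
  exact ENNReal.mul_lt_top ((laplaceOne_lt_one A hA).trans ENNReal.one_lt_top)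
    (laplaceOne_renewal_conv_lt_top hA hB)

lemma laplaceOne_evenRenewal_lt_top {A B : Measure ℝ} [IsProbabilityMeasure A]
    [IsProbabilityMeasure B] (hA : A (Iic 0) = 0) (hB : B (Iic 0) = 0) :
    laplaceOne (evenRenewal A B) < ∞ := by
  rw [evenRenewal, laplaceOne_conv, laplaceOne_conv]
  exact ENNReal.mul_lt_top (ENNReal.mul_lt_top
    ((laplaceOne_lt_one A hA).trans ENNReal.one_lt_top)
    ((laplaceOne_lt_one B hB).trans ENNReal.one_lt_top)) (laplaceOne_renewal_conv_lt_top hA hB)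

/-- `E_+(t)` is `1` minus twice the expected number of odd-numbered switches in `(0, t]` plus twice
the expected number of even-numbered ones. -/
lemma expectedValue_one {Ω : Type*} [MeasurableSpace Ω] {P : Measure Ω} [IsProbabilityMeasure P]
    {δ : Ω → ℤ} {Tp Tm : ℕ → Ω → ℝ} (h : IsSwitchData P δ Tp Tm)
    (hpos : 0 < P {ω | δ ω = 1}) (t : ℝ) :
    expectedValue P δ Tp Tm 1 t =
      1 - 2 * (oddRenewal (P.map (Tp 0)) (P.map (Tm 0))).real (Iic t)
        + 2 * (evenRenewal (P.map (Tp 0)) (P.map (Tm 0))).real (Iic t) := by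
  have hp := h.measurable_plus
  have hm := h.measurable_minus
  have hA := measure_Iic_zero_of_nonneg (hp 0) h.nonneg_plus h.absolutelyContinuous_plus
  have hB := measure_Iic_zero_of_nonneg (hm 0) h.nonneg_minus h.absolutelyContinuous_minus
  have : IsProbabilityMeasure (P.map (Tp 0)) := Measure.isProbabilityMeasure_map (hp 0).aemeasurable
  have : IsProbabilityMeasure (P.map (Tm 0)) := Measure.isProbabilityMeasure_map (hm 0).aemeasurable
  set A := P.map (Tp 0)
  set B := P.map (Tm 0)
  set Q := ProbabilityTheory.cond P {ω | δ ω = 1} with hQ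
  have : IsProbabilityMeasure Q := cond_isProbabilityMeasure hpos.ne'
  set S : ℕ → Ω → ℝ := fun n ω => altSum (fun i => Tp i ω) (fun i => Tm i ω) n with hS
  have hSm : ∀ n, Measurable (S n) := by
    intro n
    simp only [hS, altSum]
    fun_prop
  -- the counting functions and their expectations
  have hind : ∀ n, Measurable fun ω => (Iic t).indicator (1 : ℝ → ℝ≥0∞) (S n ω) := fun n =>
    (measurable_one.indicator measurableSet_Iic).comp (hSm n)
  have hcount : ∀ f : ℕ → ℕ, ∫⁻ ω, ∑' k, (Iic t).indicator (1 : ℝ → ℝ≥0∞) (S (f k) ω) ∂Q =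
      ∑' k, (convPow A ((f k + 1) / 2) ∗ convPow B (f k / 2)) (Iic t) := by
    intro f
    rw [lintegral_tsum fun k => (hind (f k)).aemeasurable]
    congr 1
    ext1 k
    rw [← map_altSum_cond h hpos (f k), ← lintegral_indicator_one measurableSet_Iic,
      lintegral_map (measurable_one.indicator measurableSet_Iic) (hSm (f k))]
  have hodd : ∫⁻ ω, ∑' k, (Iic t).indicator (1 : ℝ → ℝ≥0∞) (S (2 * k + 1) ω) ∂Q =
      oddRenewal A B (Iic t) := by
    rw [hcount (fun k => 2 * k + 1), oddRenewal_eq_sum, Measure.sum_apply _ measurableSet_Iic]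
    congr 1
    ext1 k
    rw [show (2 * k + 1 + 1) / 2 = k + 1 by omega, show (2 * k + 1) / 2 = k by omega]
  have heven : ∫⁻ ω, ∑' k, (Iic t).indicator (1 : ℝ → ℝ≥0∞) (S (2 * k + 2) ω) ∂Q =
      evenRenewal A B (Iic t) := by
    rw [hcount (fun k => 2 * k + 2), evenRenewal_eq_sum, Measure.sum_apply _ measurableSet_Iic]
    congr 1
    ext1 k
    rw [show (2 * k + 2 + 1) / 2 = k + 1 by omega, show (2 * k + 2) / 2 = k + 1 by omega]
  have hoddfin : oddRenewal A B (Iic t) < ∞ :=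
    measure_Iic_lt_top_of_laplaceOne (laplaceOne_oddRenewal_lt_top hA hB) t
  have hevenfin : evenRenewal A B (Iic t) < ∞ :=
    measure_Iic_lt_top_of_laplaceOne (laplaceOne_evenRenewal_lt_top hA hB) t
  have hmo : Measurable fun ω => ∑' k, (Iic t).indicator (1 : ℝ → ℝ≥0∞) (S (2 * k + 1) ω) :=
    Measurable.tsum fun k => hind _
  have hme : Measurable fun ω => ∑' k, (Iic t).indicator (1 : ℝ → ℝ≥0∞) (S (2 * k + 2) ω) :=
    Measurable.tsum fun k => hind _
  have hofin := ae_lt_top hmo (hodd.trans_lt hoddfin).ne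
  have hefin := ae_lt_top hme (heven.trans_lt hevenfin).ne
  have hQP : Q ≪ P := cond_absolutelyContinuous
  have hposp : ∀ᵐ ω ∂Q, ∀ i, 0 ≤ Tp i ω := by
    refine hQP.ae_le (ae_all_iff.2 fun i => ?_)
    exact (h.identDistrib_plus i).symm.ae_snd (p := fun x => 0 ≤ x) measurableSet_Ici h.nonneg_plus
  have hposm : ∀ᵐ ω ∂Q, ∀ i, 0 ≤ Tm i ω := by
    refine hQP.ae_le (ae_all_iff.2 fun i => ?_)
    exact (h.identDistrib_minus i).symm.ae_snd (p := fun x => 0 ≤ x) measurableSet_Ici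
      h.nonneg_minus
  have hsign : ∀ᵐ ω ∂Q, δ ω = 1 := ae_cond_mem (h.measurable_sign (measurableSet_singleton 1))
  have hae : ∀ᵐ ω ∂Q, process δ Tp Tm t ω =
      1 - 2 * (∑' k, (Iic t).indicator (1 : ℝ → ℝ≥0∞) (S (2 * k + 1) ω)).toReal
        + 2 * (∑' k, (Iic t).indicator (1 : ℝ → ℝ≥0∞) (S (2 * k + 2) ω)).toReal := by
    filter_upwards [hofin, hposp, hposm, hsign] with ω h1 h2 h3 h4
    rw [← neg_one_pow_ncard_eq (S := fun n => S n ω)]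
    · simp only [process, switchCount, switchTime_eq_altSum h4, h4, hS]
      simp
    · refine monotone_nat_of_le_succ fun n => ?_
      simp only [hS, altSum_succ]
      split_ifs
      · simpa using h2 _
      · simpa using h3 _
    · -- if no switch comes after `t`, the count of odd-numbered switches is infinite
      by_contra! hcon
      refine h1.ne ?_
      rw [show (fun k => (Iic t).indicator (1 : ℝ → ℝ≥0∞) (S (2 * k + 1) ω)) = fun _ => 1 from
        funext fun k => indicator_of_mem (show S (2 * k + 1) ω ∈ Iic t from hcon _) _]
      exact ENNReal.tsum_const_eq_top_of_ne_zero one_ne_zero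
  have hio : Integrable (fun ω =>
      (∑' k, (Iic t).indicator (1 : ℝ → ℝ≥0∞) (S (2 * k + 1) ω)).toReal) Q :=
    integrable_toReal_of_lintegral_ne_top hmo.aemeasurable (hodd.trans_lt hoddfin).ne
  have hie : Integrable (fun ω =>
      (∑' k, (Iic t).indicator (1 : ℝ → ℝ≥0∞) (S (2 * k + 2) ω)).toReal) Q :=
    integrable_toReal_of_lintegral_ne_top hme.aemeasurable (heven.trans_lt hevenfin).ne
  rw [expectedValue, ← hQ, integral_congr_ae hae, integral_add (by fun_prop) (by fun_prop),
    integral_sub (by fun_prop) (by fun_prop), integral_const_mul, integral_const_mul,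
    integral_toReal hmo.aemeasurable hofin, integral_toReal hme.aemeasurable hefin, hodd, heven]
  simp [Measure.real]

/-! ### Differentiation of distribution functions -/

section Differentiation

variable {μ : Measure ℝ}

lemma monotone_real_Iic (h : ∀ t, μ (Iic t) < ∞) : Monotone fun t => μ.real (Iic t) :=
  fun _ t hst => ENNReal.toReal_mono (h t).ne (measure_mono (Iic_subset_Iic.2 hst))

lemma continuousWithinAt_real_Iic (h : ∀ t, μ (Iic t) < ∞) (x : ℝ) :
    ContinuousWithinAt (fun t => μ.real (Iic t)) (Ici x) x := by
  rw [← continuousWithinAt_Ioi_iff_Ici]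
  have h1 := tendsto_measure_biInter_gt (μ := μ) (s := fun t : ℝ => Iic t) (a := x)
    (fun _ _ => measurableSet_Iic.nullMeasurableSet) (fun _ _ _ hij => Iic_subset_Iic.2 hij)
    ⟨x + 1, by simp, (h _).ne⟩
  have h2 : ⋂ r > x, Iic r = Iic x := by
    ext y
    simp only [gt_iff_lt, mem_iInter, mem_Iic]
    exact ⟨fun hy => le_of_forall_gt_imp_ge_of_dense hy, fun hy r hr => hy.trans hr.le⟩
  rw [h2] at h1
  exact (ENNReal.tendsto_toReal (h x).ne).comp h1

/-- The distribution function of a measure whose left half-lines have finite mass. -/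
noncomputable def distributionFunction (μ : Measure ℝ) (h : ∀ t, μ (Iic t) < ∞) :
    StieltjesFunction ℝ where
  toFun t := μ.real (Iic t)
  mono' := monotone_real_Iic h
  right_continuous' := continuousWithinAt_real_Iic h

lemma distributionFunction_measure (h : ∀ t, μ (Iic t) < ∞) :
    (distributionFunction μ h).measure = μ := by
  have := isLocallyFinite_of_Iic h
  refine Measure.ext_of_Ioc _ _ fun a b hab => ?_
  rw [StieltjesFunction.measure_Ioc]
  change ENNReal.ofReal (μ.real (Iic b) - μ.real (Iic a)) = _
  rw [← measureReal_sdiff (Iic_subset_Iic.2 hab.le) measurableSet_Iic (h b).ne, Iic_sdiff_Iic]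
  exact ofReal_measureReal ((measure_mono Ioc_subset_Iic_self).trans_lt (h b)).ne

lemma ae_hasDerivAt_real_Iic (h : ∀ t, μ (Iic t) < ∞) :
    ∀ᵐ x, HasDerivAt (fun t => μ.real (Iic t)) (μ.rnDeriv volume x).toReal x := by
  have h1 := (distributionFunction μ h).ae_hasDerivAt
  rw [distributionFunction_measure] at h1
  exact h1

/-- If `1 - 2 O(-∞, t] + 2 V(-∞, t]` has no positive derivative at positive times, then `O`
dominates `V`: almost everywhere the derivative is `2 (v - o)`, for the densities `o` of `O` and `v`
of `V`. -/
lemma exists_eq_add_of_deriv_nonpos {O V : Measure ℝ} (hO : ∀ t, O (Iic t) < ∞)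
    (hV : ∀ t, V (Iic t) < ∞) (hOac : O ≪ volume) (hVac : V ≪ volume) (hV0 : V (Iic 0) = 0)
    (h : ∀ t, 0 < t → ∀ d, HasDerivAt (fun t => 1 - 2 * O.real (Iic t) + 2 * V.real (Iic t)) d t →
      0 ≤ -d) : ∃ ρ : Measure ℝ, SFinite ρ ∧ O = ρ + V := by
  have := isLocallyFinite_of_Iic hO
  have := isLocallyFinite_of_Iic hV
  have hle : V.rnDeriv volume ≤ᵐ[volume] O.rnDeriv volume := by
    have h0 : ∀ᵐ x, x ∈ Iic (0 : ℝ) → V.rnDeriv volume x = 0 := by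
      rw [← ae_restrict_iff' measurableSet_Iic, ← Filter.EventuallyEq, ← Pi.zero_def,
        ← lintegral_eq_zero_iff (Measure.measurable_rnDeriv _ _),
        Measure.setLIntegral_rnDeriv hVac, hV0]
    filter_upwards [h0, ae_hasDerivAt_real_Iic hO, ae_hasDerivAt_real_Iic hV,
      Measure.rnDeriv_lt_top O volume, Measure.rnDeriv_lt_top V volume] with x h1 h2 h3 h4 h5
    by_cases hx : x ≤ 0
    · rw [h1 hx]
      exact zero_le
    · have h6 := h x (not_le.1 hx) _ (((h2.const_mul 2).const_sub 1).add (h3.const_mul 2))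
      rw [← ENNReal.toReal_le_toReal h5.ne h4.ne]
      linarith
  refine ⟨volume.withDensity (O.rnDeriv volume - V.rnDeriv volume), inferInstance, ?_⟩
  conv_lhs => rw [← Measure.withDensity_rnDeriv_eq O volume hOac]
  conv_rhs => rw [← Measure.withDensity_rnDeriv_eq V volume hVac]
  rw [← withDensity_add_right _ (Measure.measurable_rnDeriv _ _)]
  refine withDensity_congr_ae ?_
  rw [Measure.withDensity_rnDeriv_eq V volume hVac]
  filter_upwards [hle] with x hx
  simp only [Pi.add_apply, Pi.sub_apply]
  exact (tsub_add_cancel_of_le hx).symm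

/-- A measure on `(0, ∞)` is recovered from the derivative of its distribution function. -/
lemma eq_withDensity_deriv {ρ : Measure ℝ} [IsFiniteMeasure ρ] (hac : ρ ≪ volume)
    (h0 : ρ (Iic 0) = 0) : ρ = (volume.restrict (Ioi (0 : ℝ))).withDensity
      fun t => ENNReal.ofReal (deriv (fun t => ρ.real (Iic t)) t) := by
  have h1 : ρ = ρ.restrict (Ioi 0) := by
    rw [Measure.restrict_eq_self_of_ae_mem]
    rw [ae_iff]
    simp only [mem_Ioi, not_lt]
    exact h0
  conv_lhs => rw [h1, ← Measure.withDensity_rnDeriv_eq ρ volume hac,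
    restrict_withDensity measurableSet_Ioi]
  refine withDensity_congr_ae (ae_restrict_of_ae ?_)
  filter_upwards [ae_hasDerivAt_real_Iic (μ := ρ) fun t => measure_lt_top _ _,
    Measure.rnDeriv_lt_top ρ volume] with x h2 h3
  rw [h2.deriv, ENNReal.ofReal_toReal h3.ne]

end Differentiation

/-! ### The pair of renewal equations -/

section Equations

variable {A B ρ σ : Measure ℝ}

lemma oddRenewal_eq_add (A B : Measure ℝ) [SFinite A] [SFinite B] :
    oddRenewal A B = A + A ∗ evenRenewal A B := by
  rw [oddRenewal, evenRenewal]
  conv_lhs => rw [renewal_eq]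
  rw [Measure.conv_add, Measure.conv_dirac_zero]

lemma evenRenewal_eq_conv (A B : Measure ℝ) [SFinite A] [SFinite B] :
    evenRenewal A B = A ∗ oddRenewal B A := by
  rw [oddRenewal, evenRenewal, Measure.conv_assoc, Measure.conv_comm B A]

lemma conv_absolutelyContinuous_left [SFinite A] [SFinite B] (h : A ≪ volume) :
    A ∗ B ≪ volume := by
  rw [Measure.conv_comm]
  exact Measure.conv_absolutelyContinuous h

variable [IsProbabilityMeasure A] [IsProbabilityMeasure B]

/-- If `A = ρ + A ∗ σ` and `B = σ + B ∗ ρ`, then eliminating `σ` leads to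
`ρ + A ∗ B = A + A ∗ B ∗ ρ`, and so `ρ` is the difference of the odd and the even renewal
measures. -/
lemma oddRenewal_eq_of_equations [SFinite ρ] [SFinite σ] (hA0 : A (Iic 0) = 0) (hB0 : B (Iic 0) = 0)
    (hA : A = ρ + A ∗ σ) (hB : B = σ + B ∗ ρ) : oddRenewal A B = ρ + evenRenewal A B := by
  set V := evenRenewal A B with hV
  set R := renewal (A ∗ B) with hR
  have hRV : R = Measure.dirac 0 + V := renewal_eq _
  have hVR : V = R ∗ (A ∗ B) := Measure.conv_comm _ _
  have hOR : oddRenewal A B = R ∗ A := Measure.conv_comm _ _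
  have helim : ρ + A ∗ B = A + (A ∗ B) ∗ ρ := by
    conv_lhs => rw [hB, Measure.conv_add, ← add_assoc, ← hA]
    rw [Measure.conv_assoc]
  have hmul : R ∗ ρ + V = oddRenewal A B + V ∗ ρ := by
    rw [hOR, hVR, ← Measure.conv_add, helim, Measure.conv_add, Measure.conv_assoc R]
  have hRρ : R ∗ ρ = ρ + V ∗ ρ := by
    rw [hRV, Measure.add_conv, Measure.dirac_zero_conv]
  have hfin : laplaceOne (V ∗ ρ) < ∞ := by
    rw [laplaceOne_conv]
    refine ENNReal.mul_lt_top (laplaceOne_evenRenewal_lt_top hA0 hB0) ?_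
    refine lt_of_le_of_lt ?_ ((laplaceOne_lt_one A hA0).trans ENNReal.one_lt_top)
    rw [hA, laplaceOne_add]
    exact le_self_add
  have := locallyFinite_of_laplaceOne hfin
  -- `V ∗ ρ` is locally finite, so it may be cancelled
  rw [hRρ, add_comm ρ, add_assoc, add_comm _ (V ∗ ρ), Measure.add_right_inj] at hmul
  exact hmul.symm

/-- If the odd renewal measures dominate the even one by `ρ` and `σ`, then `A = ρ + A ∗ σ`. -/
lemma eq_add_conv_of_oddRenewal_eq [SFinite ρ] [SFinite σ] (hA0 : A (Iic 0) = 0)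
    (hB0 : B (Iic 0) = 0) (hρ : oddRenewal A B = ρ + evenRenewal A B)
    (hσ : oddRenewal B A = σ + evenRenewal B A) : A = ρ + A ∗ σ := by
  have h1 : A + A ∗ evenRenewal A B = ρ + (A ∗ σ + A ∗ evenRenewal A B) := by
    rw [← oddRenewal_eq_add, hρ, ← Measure.conv_add, evenRenewal_comm A B, ← hσ,
      ← evenRenewal_eq_conv, evenRenewal_comm]
  have hfin : laplaceOne (A ∗ evenRenewal A B) < ∞ := by
    rw [laplaceOne_conv]
    exact ENNReal.mul_lt_top ((laplaceOne_lt_one A hA0).trans ENNReal.one_lt_top)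
      (laplaceOne_evenRenewal_lt_top hA0 hB0)
  have := locallyFinite_of_laplaceOne hfin
  rwa [← add_assoc, add_comm A, add_comm (ρ + A ∗ σ), Measure.add_right_inj] at h1

lemma lintegral_ofReal_conv {μ ν : Measure ℝ} [SFinite ν] (hμ : μ (Iic 0) = 0)
    (hν : ν (Iic 0) = 0) : ∫⁻ x, ENNReal.ofReal x ∂(μ ∗ ν) =
      (∫⁻ x, ENNReal.ofReal x ∂μ) * ν univ + μ univ * ∫⁻ x, ENNReal.ofReal x ∂ν := by
  have h1 : ∀ {κ : Measure ℝ}, κ (Iic 0) = 0 → ∀ᵐ x ∂κ, 0 ≤ x := by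
    intro κ h
    rw [ae_iff]
    simp only [not_le]
    exact measure_mono_null Iio_subset_Iic_self h
  rw [Measure.lintegral_conv (by fun_prop)]
  calc ∫⁻ x, ∫⁻ y, ENNReal.ofReal (x + y) ∂ν ∂μ
      = ∫⁻ x, (ENNReal.ofReal x * ν univ + ∫⁻ y, ENNReal.ofReal y ∂ν) ∂μ := by
        refine lintegral_congr_ae ?_
        filter_upwards [h1 hμ] with x hx
        rw [← lintegral_const, ← lintegral_add_left (by fun_prop)]
        refine lintegral_congr_ae ?_
        filter_upwards [h1 hν] with y hy
        exact ENNReal.ofReal_add hx hy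
    _ = _ := by
        rw [lintegral_add_left (by fun_prop), lintegral_mul_const _ (by fun_prop),
          lintegral_const, mul_comm (∫⁻ y, ENNReal.ofReal y ∂ν)]

/-- The total masses in the pair of renewal equations come from comparing means:
`μ_A ρ(ℝ)` and `μ_B σ(ℝ)` both equal the sum of the first moments of `ρ` and `σ`. -/
lemma measure_univ_of_equations (hA0 : A (Iic 0) = 0) (hB0 : B (Iic 0) = 0)
    (hA : A = ρ + A ∗ σ) (hB : B = σ + B ∗ ρ) [SFinite ρ] [SFinite σ] {a b : ℝ} (ha : 0 < a)
    (hb : 0 < b) (hma : ∫⁻ x, ENNReal.ofReal x ∂A = ENNReal.ofReal a)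
    (hmb : ∫⁻ x, ENNReal.ofReal x ∂B = ENNReal.ofReal b) :
    ρ univ = ENNReal.ofReal (b / (a + b)) := by
  have hρA : ρ ≤ A := by
    conv_rhs => rw [hA]
    exact Measure.le_add_right le_rfl
  have hσB : σ ≤ B := by
    conv_rhs => rw [hB]
    exact Measure.le_add_right le_rfl
  have hρ0 : ρ (Iic 0) = 0 := le_antisymm ((hρA _).trans_eq hA0) zero_le
  have hσ0 : σ (Iic 0) = 0 := le_antisymm ((hσB _).trans_eq hB0) zero_le
  have hr : ρ univ ≠ ∞ := ne_top_of_le_ne_top (by simp) (hρA univ)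
  have hs : σ univ ≠ ∞ := ne_top_of_le_ne_top (by simp) (hσB univ)
  have hmass : (1 : ℝ≥0∞) = ρ univ + σ univ := by
    have h := congrArg (fun μ : Measure ℝ => μ univ) hA
    simpa [conv_univ] using h
  have hmr : ∫⁻ x, ENNReal.ofReal x ∂ρ ≠ ∞ :=
    ne_top_of_le_ne_top (by simp) ((lintegral_mono' hρA le_rfl).trans_eq hma)
  have hms : ∫⁻ x, ENNReal.ofReal x ∂σ ≠ ∞ :=
    ne_top_of_le_ne_top (by simp) ((lintegral_mono' hσB le_rfl).trans_eq hmb)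
  have h1 : ENNReal.ofReal a = ∫⁻ x, ENNReal.ofReal x ∂ρ +
      (ENNReal.ofReal a * σ univ + ∫⁻ x, ENNReal.ofReal x ∂σ) := by
    have h := congrArg (fun μ : Measure ℝ => ∫⁻ x, ENNReal.ofReal x ∂μ) hA
    simpa [lintegral_add_measure, lintegral_ofReal_conv hA0 hσ0, hma] using h
  have h2 : ENNReal.ofReal b = ∫⁻ x, ENNReal.ofReal x ∂σ +
      (ENNReal.ofReal b * ρ univ + ∫⁻ x, ENNReal.ofReal x ∂ρ) := by
    have h := congrArg (fun μ : Measure ℝ => ∫⁻ x, ENNReal.ofReal x ∂μ) hB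
    simpa [lintegral_add_measure, lintegral_ofReal_conv hB0 hρ0, hmb] using h
  lift ρ univ to NNReal using hr with r
  lift σ univ to NNReal using hs with s
  lift ∫⁻ x, ENNReal.ofReal x ∂ρ to NNReal using hmr with mr
  lift ∫⁻ x, ENNReal.ofReal x ∂σ to NNReal using hms with ms
  have e0 : (1 : ℝ) = r + s := by exact_mod_cast hmass
  rw [ENNReal.ofReal] at h1 h2
  norm_cast at h1 h2
  have e1 := congrArg NNReal.toReal h1
  have e2 := congrArg NNReal.toReal h2
  push_cast [Real.coe_toNNReal a ha.le, Real.coe_toNNReal b hb.le] at e1 e2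
  have e3 : (r : ℝ) = b / (a + b) := by
    rw [eq_div_iff (by positivity)]
    have e4 : (s : ℝ) = 1 - r := by linarith
    rw [e4] at e1
    linarith
  rw [← e3, ENNReal.ofReal_coe_nnreal]

end Equations

/-! ### Geometric random sums -/

section GeometricSums

variable {Ω : Type*} [MeasurableSpace Ω] {Q : Measure Ω} {p : ℝ} {ν : Ω → ℕ}

lemma tsum_ofReal_geometric (hp0 : 0 < p) (hp1 : p ≤ 1) :
    ∑' k : ℕ, ENNReal.ofReal ((1 - p) ^ k * p) = 1 := by
  have h := hasSum_one_geometricMeasure (p := ⟨p, hp0.le, hp1⟩)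
    (by simpa [← Subtype.coe_ne_coe] using hp0.ne')
  rw [← ENNReal.ofReal_tsum_of_nonneg (fun k => mul_nonneg (pow_nonneg (by linarith) k) hp0.le)
    h.summable, h.tsum_eq, ENNReal.ofReal_one]

lemma measure_eq_tsum_inter_fiber (hν : Measurable ν) {E : Set Ω} (hE : MeasurableSet E) :
    Q E = ∑' n, Q ({ω | ν ω = n} ∩ E) := by
  have h1 : ∀ n, MeasurableSet {ω | ν ω = n} := fun n => hν (measurableSet_singleton n)
  rw [← measure_iUnion _ fun n => (h1 n).inter hE]
  · congr 1
    ext ω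
    simp
  · intro i j hij
    refine disjoint_left.2 fun ω hi hj => hij ?_
    exact hi.1.symm.trans hj.1

/-- The probabilities prescribed on `{1, 2, …}` add up to one and leave nothing for `0`. -/
lemma IsGeometric.measure_zero [IsProbabilityMeasure Q] (h : IsGeometric Q ν p) (hp0 : 0 < p)
    (hp1 : p ≤ 1) : Q {ω | ν ω = 0} = 0 := by
  have h1 := measure_eq_tsum_inter_fiber (Q := Q) h.1 MeasurableSet.univ
  simp only [inter_univ, measure_univ] at h1
  rw [tsum_eq_zero_add' ENNReal.summable] at h1
  simp_rw [h.2 _ (Nat.le_add_left 1 _), Nat.add_sub_cancel] at h1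
  rw [tsum_ofReal_geometric hp0 hp1] at h1
  exact (ENNReal.add_left_inj ENNReal.one_ne_top).1 (by rw [zero_add, ← h1])

lemma map_add_sum_Icc [IsProbabilityMeasure Q] {X Y : ℕ → Ω → ℝ} (hX : ∀ k, Measurable (X k))
    (hY : ∀ k, Measurable (Y k)) (hidY : ∀ k, IdentDistrib (Y k) (Y 0) Q Q)
    (hindY : iIndepFun Y Q) (hXY : IndepFun (fun ω k => X k ω) (fun ω k => Y k ω) Q) (n : ℕ) :
    Q.map (fun ω => X 0 ω + ∑ k ∈ Finset.Icc 1 n, Y k ω) =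
      Q.map (X 0) ∗ convPow (Q.map (Y 0)) n := by
  have h1 : ∀ ω, ∑ k ∈ Finset.Icc 1 n, Y k ω = ∑ k ∈ Finset.range n, Y (k + 1) ω := by
    intro ω
    induction n with
    | zero => simp
    | succ n ih => rw [Finset.sum_Icc_succ_top (by omega), ih, Finset.sum_range_succ]
  have h2 := map_sum_range (X := fun k => Y (k + 1)) (fun k => hY _)
    (fun k => (hidY _).trans (hidY 1).symm) (hindY.precomp (add_left_injective 1)) n
  rw [(hidY _).map_eq] at h2
  simp_rw [h1]
  rw [← h2]
  refine IndepFun.map_add_eq_map_conv_map (hX 0) (by fun_prop) ?_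
  exact hXY.comp (φ := fun x : ℕ → ℝ => x 0)
    (ψ := fun x : ℕ → ℝ => ∑ i ∈ Finset.range n, x (i + 1)) (by fun_prop) (by fun_prop)

lemma measurable_geometric_sum {X Y : ℕ → Ω → ℝ} (hX : ∀ k, Measurable (X k))
    (hY : ∀ k, Measurable (Y k)) (hν : Measurable ν) :
    Measurable fun ω => X 0 ω + ∑ k ∈ Finset.Icc 1 (ν ω - 1), Y k ω := by
  refine (hX 0).add ?_
  exact (measurable_from_prod_countable_right (f := fun q : ℕ × Ω =>
    ∑ k ∈ Finset.Icc 1 (q.1 - 1), Y k q.2) fun n =>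
      Finset.measurable_sum (Finset.Icc 1 (n - 1)) fun k _ => hY k).comp (hν.prodMk measurable_id)

/-- The law of `X + ∑_{k=1}^{ν-1} Yₖ` with a geometric `ν`: the weights of `ν` turn the convolution
powers of the law of `Y` into the renewal measure of a defective measure. -/
lemma map_geometric_sum [IsProbabilityMeasure Q] {X Y : ℕ → Ω → ℝ} (hX : ∀ k, Measurable (X k))
    (hY : ∀ k, Measurable (Y k)) (hidY : ∀ k, IdentDistrib (Y k) (Y 0) Q Q)
    (hindY : iIndepFun Y Q) (hXY : IndepFun (fun ω k => X k ω) (fun ω k => Y k ω) Q)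
    (hν : IsGeometric Q ν p)
    (hνXY : IndepFun ν (fun ω => (fun k => X k ω, fun k => Y k ω)) Q)
    (hp0 : 0 < p) (hp1 : p ≤ 1) :
    Q.map (fun ω => X 0 ω + ∑ k ∈ Finset.Icc 1 (ν ω - 1), Y k ω) =
      (ENNReal.ofReal p • Q.map (X 0)) ∗ renewal (ENNReal.ofReal (1 - p) • Q.map (Y 0)) := by
  have hmeas := measurable_geometric_sum hX hY hν.1
  ext s hs
  rw [Measure.map_apply hmeas hs, measure_eq_tsum_inter_fiber hν.1 (hmeas hs),
    tsum_eq_zero_add' ENNReal.summable,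
    measure_mono_null inter_subset_left (hν.measure_zero hp0 hp1), zero_add, renewal, conv_sum,
    Measure.sum_apply _ hs]
  congr 1
  ext1 n
  have h1 : {ω | ν ω = n + 1} ∩ (fun ω => X 0 ω + ∑ k ∈ Finset.Icc 1 (ν ω - 1), Y k ω) ⁻¹' s =
      ν ⁻¹' {n + 1} ∩ (fun ω => X 0 ω + ∑ k ∈ Finset.Icc 1 n, Y k ω) ⁻¹' s := by
    ext ω
    simp only [mem_inter_iff, mem_ofPred_eq, mem_preimage, mem_singleton_iff]
    refine and_congr_right fun h => ?_
    rw [h, Nat.add_sub_cancel]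
  have h2 : IndepFun ν (fun ω => X 0 ω + ∑ k ∈ Finset.Icc 1 n, Y k ω) Q :=
    hνXY.comp (φ := id) (ψ := fun x : (ℕ → ℝ) × (ℕ → ℝ) => x.1 0 + ∑ k ∈ Finset.Icc 1 n, x.2 k)
      measurable_id (by fun_prop)
  have h3 : Q (ν ⁻¹' {n + 1}) = ENNReal.ofReal ((1 - p) ^ n * p) := by
    have h := hν.2 (n + 1) (by omega)
    rwa [Nat.add_sub_cancel] at h
  rw [h1, h2.measure_inter_preimage_eq_mul _ _ (measurableSet_singleton _) hs, h3,
    ← Measure.map_apply (by fun_prop) hs, map_add_sum_Icc hX hY hidY hindY hXY, convPow_smul,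
    Measure.conv_smul_left, Measure.conv_smul_right, smul_smul, Measure.smul_apply, smul_eq_mul,
    ← ENNReal.ofReal_pow (by linarith), ← ENNReal.ofReal_mul hp0.le, mul_comm p]

end GeometricSums

/-! ### Representations and the pair of renewal equations -/

section Representation

variable {Ω Ω' : Type*} [MeasurableSpace Ω] [MeasurableSpace Ω'] {P : Measure Ω}
  {Q : Measure Ω'} {Tp Tm : Ω → ℝ} {α β : ℝ} {X Y : ℕ → Ω' → ℝ} {νa νb : Ω' → ℕ}

/-- Exchanging the two signs. -/
lemma IsRepresentation.swap (h : IsRepresentation P Tp Tm α β Q X Y νa νb) :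
    IsRepresentation P Tm Tp β α Q Y X νb νa where
  measurable_X := h.measurable_Y
  measurable_Y := h.measurable_X
  identDistrib_X := h.identDistrib_Y
  identDistrib_Y := h.identDistrib_X
  geometric_a := h.geometric_b
  geometric_b := h.geometric_a
  indep_X := h.indep_Y
  indep_Y := h.indep_X
  indep_X_Y := h.indep_X_Y.symm
  indep_a_b := h.indep_a_b.symm
  indep_ab_XY := h.indep_ab_XY.comp (φ := Prod.swap) (ψ := Prod.swap) measurable_swap
    measurable_swap
  plus := h.minus
  minus := h.plus

/-- In a representation, the measures `α P_X` and `β P_Y` solve the renewal equation. -/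
lemma IsRepresentation.eq_add_conv [SFinite P] [IsProbabilityMeasure Q]
    (h : IsRepresentation P Tp Tm α β Q X Y νa νb) (hα : 0 < α) (hβ : 0 < β) (hαβ : α + β = 1) :
    P.map Tp = ENNReal.ofReal α • Q.map (X 0) + P.map Tp ∗ (ENNReal.ofReal β • Q.map (Y 0)) := by
  have h1 := map_geometric_sum h.measurable_X h.measurable_Y h.identDistrib_Y h.indep_Y h.indep_X_Y
    h.geometric_a (h.indep_ab_XY.comp (φ := Prod.fst) (ψ := id) measurable_fst measurable_id) hα
    (by linarith)
  rw [← h.plus.map_eq, show 1 - α = β by linarith] at h1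
  conv_lhs => rw [h1, renewal_eq, Measure.conv_add, Measure.conv_dirac_zero, conv_left_comm, ← h1]
  rw [Measure.conv_comm]

/-- The law of a geometric variable with values in `{1, 2, …}`. -/
noncomputable def geometricLaw (p : unitInterval) : Measure ℕ :=
  (geometricMeasure p).map Nat.succ

instance (p : unitInterval) : IsProbabilityMeasure (geometricLaw p) :=
  Measure.isProbabilityMeasure_map (by fun_prop)

lemma geometricLaw_singleton {p : unitInterval} (hp : p ≠ 0) {k : ℕ} (hk : 1 ≤ k) :
    geometricLaw p {k} = ENNReal.ofReal ((1 - p) ^ (k - 1) * p) := by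
  obtain ⟨n, rfl⟩ : ∃ n, k = n + 1 := ⟨k - 1, by omega⟩
  rw [geometricLaw, Measure.map_apply (by fun_prop) (measurableSet_singleton _),
    Nat.add_sub_cancel, ← geometricMeasure_singleton hp]
  congr 1
  ext m
  simp

/-- Solutions of the pair of renewal equations give a representation, on the product of the
sample spaces of the two geometric variables and the two iid sequences. -/
lemma exists_isRepresentation [IsProbabilityMeasure P] (hTp : Measurable Tp) (hTm : Measurable Tm)
    {ρ σ : Measure ℝ} [SFinite ρ] [SFinite σ] (hA : P.map Tp = ρ + P.map Tp ∗ σ)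
    (hB : P.map Tm = σ + P.map Tm ∗ ρ) (hα : 0 < α) (hβ : 0 < β) (hαβ : α + β = 1)
    (hρ : ρ univ = ENNReal.ofReal α) (hσ : σ univ = ENNReal.ofReal β) :
    ∃ (Ω' : Type) (_ : MeasurableSpace Ω') (Q : Measure Ω') (_ : IsProbabilityMeasure Q)
      (X Y : ℕ → Ω' → ℝ) (νa νb : Ω' → ℕ), IsRepresentation P Tp Tm α β Q X Y νa νb := by
  have hα' : ENNReal.ofReal α ≠ 0 := by simpa using hα
  have hβ' : ENNReal.ofReal β ≠ 0 := by simpa using hβ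
  set μX : Measure ℝ := (ENNReal.ofReal α)⁻¹ • ρ with hμX
  set μY : Measure ℝ := (ENNReal.ofReal β)⁻¹ • σ with hμY
  have : IsProbabilityMeasure μX :=
    ⟨by rw [hμX, Measure.smul_apply, hρ, smul_eq_mul, ENNReal.inv_mul_cancel hα' (by simp)]⟩
  have : IsProbabilityMeasure μY :=
    ⟨by rw [hμY, Measure.smul_apply, hσ, smul_eq_mul, ENNReal.inv_mul_cancel hβ' (by simp)]⟩
  have hρX : ENNReal.ofReal α • μX = ρ := by
    rw [hμX, smul_smul, ENNReal.mul_inv_cancel hα' (by simp), one_smul]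
  have hσY : ENNReal.ofReal β • μY = σ := by
    rw [hμY, smul_smul, ENNReal.mul_inv_cancel hβ' (by simp), one_smul]
  have : IsProbabilityMeasure (P.map Tp) := Measure.isProbabilityMeasure_map hTp.aemeasurable
  have : IsProbabilityMeasure (P.map Tm) := Measure.isProbabilityMeasure_map hTm.aemeasurable
  set a : unitInterval := ⟨α, hα.le, by linarith⟩ with ha
  set b : unitInterval := ⟨β, hβ.le, by linarith⟩ with hb
  have ha0 : a ≠ 0 := by simpa [ha, ← Subtype.coe_ne_coe] using hα.ne'
  have hb0 : b ≠ 0 := by simpa [hb, ← Subtype.coe_ne_coe] using hβ.ne'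
  let QX : Measure (ℕ → ℝ) := Measure.infinitePi fun _ => μX
  let QY : Measure (ℕ → ℝ) := Measure.infinitePi fun _ => μY
  let Qν : Measure (ℕ × ℕ) := (geometricLaw a).prod (geometricLaw b)
  let Q : Measure ((ℕ × ℕ) × ((ℕ → ℝ) × (ℕ → ℝ))) := Qν.prod (QX.prod QY)
  have mpν : MeasurePreserving (fun ω : (ℕ × ℕ) × ((ℕ → ℝ) × (ℕ → ℝ)) => ω.1) Q Qν :=
    measurePreserving_fst
  have mpXY : MeasurePreserving (fun ω : (ℕ × ℕ) × ((ℕ → ℝ) × (ℕ → ℝ)) => ω.2) Q (QX.prod QY) :=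
    measurePreserving_snd
  have mpa := (measurePreserving_fst (μ := geometricLaw a) (ν := geometricLaw b)).comp mpν
  have mpb := (measurePreserving_snd (μ := geometricLaw a) (ν := geometricLaw b)).comp mpν
  have mpX := (measurePreserving_fst (μ := QX) (ν := QY)).comp mpXY
  have mpY := (measurePreserving_snd (μ := QX) (ν := QY)).comp mpXY
  let X : ℕ → (ℕ × ℕ) × ((ℕ → ℝ) × (ℕ → ℝ)) → ℝ := fun k ω => ω.2.1 k
  let Y : ℕ → (ℕ × ℕ) × ((ℕ → ℝ) × (ℕ → ℝ)) → ℝ := fun k ω => ω.2.2 k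
  let νa : (ℕ × ℕ) × ((ℕ → ℝ) × (ℕ → ℝ)) → ℕ := fun ω => ω.1.1
  let νb : (ℕ × ℕ) × ((ℕ → ℝ) × (ℕ → ℝ)) → ℕ := fun ω => ω.1.2
  have hXm : ∀ k, Measurable (X k) := fun k => by fun_prop
  have hYm : ∀ k, Measurable (Y k) := fun k => by fun_prop
  have hXlaw : ∀ k, Q.map (X k) = μX := fun k =>
    ((measurePreserving_eval_infinitePi (fun _ : ℕ => μX) k).comp mpX).map_eq
  have hYlaw : ∀ k, Q.map (Y k) = μY := fun k =>
    ((measurePreserving_eval_infinitePi (fun _ : ℕ => μY) k).comp mpY).map_eq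
  have hXid : ∀ k, IdentDistrib (X k) (X 0) Q Q := fun k =>
    ⟨(hXm k).aemeasurable, (hXm 0).aemeasurable, by rw [hXlaw, hXlaw]⟩
  have hYid : ∀ k, IdentDistrib (Y k) (Y 0) Q Q := fun k =>
    ⟨(hYm k).aemeasurable, (hYm 0).aemeasurable, by rw [hYlaw, hYlaw]⟩
  have hXind : iIndepFun X Q := by
    rw [iIndepFun_iff_map_fun_eq_infinitePi_map hXm]
    simp_rw [hXlaw]
    exact mpX.map_eq
  have hYind : iIndepFun Y Q := by
    rw [iIndepFun_iff_map_fun_eq_infinitePi_map hYm]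
    simp_rw [hYlaw]
    exact mpY.map_eq
  have hXY : IndepFun (fun ω k => X k ω) (fun ω k => Y k ω) Q := by
    rw [indepFun_iff_map_prod_eq_prod_map_map (by fun_prop) (by fun_prop)]
    exact mpXY.map_eq.trans (congrArg₂ Measure.prod mpX.map_eq.symm mpY.map_eq.symm)
  have hab : IndepFun νa νb Q := by
    rw [indepFun_iff_map_prod_eq_prod_map_map (by fun_prop) (by fun_prop)]
    exact mpν.map_eq.trans (congrArg₂ Measure.prod mpa.map_eq.symm mpb.map_eq.symm)
  have habXY : IndepFun (fun ω => (νa ω, νb ω)) (fun ω => (fun k => X k ω, fun k => Y k ω)) Q :=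
    indepFun_prod (X := fun ω : ℕ × ℕ => ω) (Y := fun ω : (ℕ → ℝ) × (ℕ → ℝ) => ω)
      measurable_id measurable_id
  have hνa : IsGeometric Q νa α := by
    refine ⟨by fun_prop, fun k hk => ?_⟩
    rw [← geometricLaw_singleton ha0 hk, ← mpa.map_eq,
      Measure.map_apply (by fun_prop) (measurableSet_singleton _)]
    rfl
  have hνb : IsGeometric Q νb β := by
    refine ⟨by fun_prop, fun k hk => ?_⟩
    rw [← geometricLaw_singleton hb0 hk, ← mpb.map_eq,
      Measure.map_apply (by fun_prop) (measurableSet_singleton _)]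
    rfl
  refine ⟨_, inferInstance, Q, inferInstance, X, Y, νa, νb, hXm, hYm, hXid, hYid, hνa, hνb,
    hXind, hYind, hXY, hab, habXY,
    ⟨hTp.aemeasurable, (measurable_geometric_sum hXm hYm hνa.1).aemeasurable, ?_⟩,
    ⟨hTm.aemeasurable, (measurable_geometric_sum hYm hXm hνb.1).aemeasurable, ?_⟩⟩
  · rw [map_geometric_sum hXm hYm hYid hYind hXY hνa
      (habXY.comp (φ := Prod.fst) (ψ := id) measurable_fst measurable_id) hα (by linarith),
      hXlaw, hYlaw, show 1 - α = β by linarith, hρX, hσY]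
    refine eq_conv_renewal ?_ hA
    rw [hσ]
    exact ENNReal.ofReal_lt_one.2 (by linarith)
  · rw [map_geometric_sum hYm hXm hXid hXind hXY.symm hνb
      (habXY.comp (φ := Prod.snd) (ψ := Prod.swap) measurable_snd measurable_swap) hβ
      (by linarith), hXlaw, hYlaw, show 1 - β = α by linarith, hρX, hσY]
    refine eq_conv_renewal ?_ hB
    rw [hρ]
    exact ENNReal.ofReal_lt_one.2 (by linarith)

end Representation

/-! ### Expected value functions and representations -/

lemma ae_differentiableAt_one_sub_add {O V : Measure ℝ} (hO : ∀ t, O (Iic t) < ∞)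
    (hV : ∀ t, V (Iic t) < ∞) :
    ∀ᵐ t, DifferentiableAt ℝ (fun t => 1 - 2 * O.real (Iic t) + 2 * V.real (Iic t)) t := by
  filter_upwards [ae_hasDerivAt_real_Iic hO, ae_hasDerivAt_real_Iic hV] with t h1 h2
  exact (((h1.const_mul 2).const_sub 1).add (h2.const_mul 2)).differentiableAt

lemma one_sub_add_eq {O V ρ : Measure ℝ} [IsFiniteMeasure ρ] (hV : ∀ t, V (Iic t) < ∞)
    (h : O = ρ + V) :
    (fun t => 1 - 2 * O.real (Iic t) + 2 * V.real (Iic t)) = fun t => 1 - 2 * ρ.real (Iic t) := by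
  ext t
  rw [h, measureReal_add_apply (measure_ne_top _ _) (hV t).ne]
  ring

lemma nonneg_neg_of_hasDerivAt {ρ : Measure ℝ} [IsFiniteMeasure ρ] {t d : ℝ}
    (h : HasDerivAt (fun t => 1 - 2 * ρ.real (Iic t)) d t) : 0 ≤ -d := by
  have hmono : Monotone fun t => -(1 - 2 * ρ.real (Iic t)) := by
    intro s t hst
    have := monotone_real_Iic (μ := ρ) (fun _ => measure_lt_top _ _) hst
    simp only at this ⊢
    linarith
  exact h.neg.nonneg_of_monotone hmono

/-- The density of a law `μ` such that `O - V = c μ`. -/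
lemma eq_withDensity_of_eq_smul_add {O V μ : Measure ℝ} [IsProbabilityMeasure μ] {c : ℝ}
    (hc : 0 < c) (hV : ∀ t, V (Iic t) < ∞) (h : O = ENNReal.ofReal c • μ + V)
    (hac : μ ≪ volume) (h0 : μ (Iic 0) = 0) :
    μ = (volume.restrict (Ioi (0 : ℝ))).withDensity fun t => ENNReal.ofReal
      (-(1 / (2 * c)) * deriv (fun t => 1 - 2 * O.real (Iic t) + 2 * V.real (Iic t)) t) := by
  have : IsFiniteMeasure (ENNReal.ofReal c • μ) := Measure.smul_finite μ ENNReal.ofReal_ne_top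
  rw [one_sub_add_eq hV h]
  conv_lhs => rw [eq_withDensity_deriv hac h0]
  congr 1
  ext1 t
  have h1 : ∀ t, 1 - 2 * (ENNReal.ofReal c • μ).real (Iic t) = 1 - (2 * c) * μ.real (Iic t) := by
    intro t
    rw [measureReal_ennreal_smul_apply, ENNReal.toReal_ofReal hc.le]
    ring
  simp_rw [h1, deriv_const_sub, deriv_const_mul_field]
  congr 1
  field_simp

/-- The expected value function of the switch process started at `1`, in terms of the laws `A` and
`B` of the switching times. -/
noncomputable def meanFunction (A B : Measure ℝ) (t : ℝ) : ℝ :=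
  1 - 2 * (oddRenewal A B).real (Iic t) + 2 * (evenRenewal A B).real (Iic t)

section MeanFunction

variable {A B : Measure ℝ} [IsProbabilityMeasure A] [IsProbabilityMeasure B]

lemma oddRenewal_Iic_lt_top (hA : A (Iic 0) = 0) (hB : B (Iic 0) = 0) (t : ℝ) :
    oddRenewal A B (Iic t) < ∞ :=
  measure_Iic_lt_top_of_laplaceOne (laplaceOne_oddRenewal_lt_top hA hB) t

lemma evenRenewal_Iic_lt_top (hA : A (Iic 0) = 0) (hB : B (Iic 0) = 0) (t : ℝ) :
    evenRenewal A B (Iic t) < ∞ :=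
  measure_Iic_lt_top_of_laplaceOne (laplaceOne_evenRenewal_lt_top hA hB) t

lemma evenRenewal_Iic_zero (hA : A (Iic 0) = 0) (hB : B (Iic 0) = 0) :
    evenRenewal A B (Iic 0) = 0 := by
  have h : ∀ k, (convPow (A ∗ B) k) (Iio 0) = 0 := by
    intro k
    induction k with
    | zero => simp [convPow]
    | succ k ih =>
      rw [convPow, Measure.conv_comm]
      exact measure_mono_null Iio_subset_Iic_self (conv_Iic_zero
        (conv_Iic_zero hA (measure_mono_null Iio_subset_Iic_self hB)) ih)
  refine conv_Iic_zero (conv_Iic_zero hA (measure_mono_null Iio_subset_Iic_self hB)) ?_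
  rw [renewal, Measure.sum_apply _ measurableSet_Iio]
  simp [h]

lemma exists_eq_add_of_meanFunction (hA0 : A (Iic 0) = 0) (hB0 : B (Iic 0) = 0)
    (hA : A ≪ volume)
    (h : ∀ t, 0 < t → ∀ d, HasDerivAt (meanFunction A B) d t → 0 ≤ -d) :
    ∃ ρ : Measure ℝ, SFinite ρ ∧ oddRenewal A B = ρ + evenRenewal A B :=
  exists_eq_add_of_deriv_nonpos (oddRenewal_Iic_lt_top hA0 hB0) (evenRenewal_Iic_lt_top hA0 hB0)
    (conv_absolutelyContinuous_left hA)
    (conv_absolutelyContinuous_left (conv_absolutelyContinuous_left hA))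
    (evenRenewal_Iic_zero hA0 hB0) h

end MeanFunction

section Consequences

variable {Ω Ω' : Type*} [MeasurableSpace Ω] [MeasurableSpace Ω'] {P : Measure Ω}
  [IsProbabilityMeasure P] {Q : Measure Ω'} [IsProbabilityMeasure Q] {Tp Tm : Ω → ℝ} {α β : ℝ}
  {X Y : ℕ → Ω' → ℝ} {νa νb : Ω' → ℕ}

lemma IsRepresentation.oddRenewal_eq (h : IsRepresentation P Tp Tm α β Q X Y νa νb) (hα : 0 < α)
    (hβ : 0 < β) (hαβ : α + β = 1) (hA0 : P.map Tp (Iic 0) = 0) (hB0 : P.map Tm (Iic 0) = 0) :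
    oddRenewal (P.map Tp) (P.map Tm) =
      ENNReal.ofReal α • Q.map (X 0) + evenRenewal (P.map Tp) (P.map Tm) := by
  have : IsProbabilityMeasure (P.map Tp) :=
    Measure.isProbabilityMeasure_map h.plus.aemeasurable_fst
  have : IsProbabilityMeasure (P.map Tm) :=
    Measure.isProbabilityMeasure_map h.minus.aemeasurable_fst
  exact oddRenewal_eq_of_equations hA0 hB0 (h.eq_add_conv hα hβ hαβ)
    (h.swap.eq_add_conv hβ hα (by rwa [add_comm]))

lemma IsRepresentation.nonneg_neg (h : IsRepresentation P Tp Tm α β Q X Y νa νb) (hα : 0 < α)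
    (hβ : 0 < β) (hαβ : α + β = 1) (hA0 : P.map Tp (Iic 0) = 0) (hB0 : P.map Tm (Iic 0) = 0)
    {t d : ℝ} (hd : HasDerivAt (meanFunction (P.map Tp) (P.map Tm)) d t) : 0 ≤ -d := by
  have : IsProbabilityMeasure (P.map Tp) :=
    Measure.isProbabilityMeasure_map h.plus.aemeasurable_fst
  have : IsProbabilityMeasure (P.map Tm) :=
    Measure.isProbabilityMeasure_map h.minus.aemeasurable_fst
  have : IsFiniteMeasure (ENNReal.ofReal α • Q.map (X 0)) :=
    Measure.smul_finite _ ENNReal.ofReal_ne_top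
  have h1 := one_sub_add_eq (evenRenewal_Iic_lt_top hA0 hB0) (h.oddRenewal_eq hα hβ hαβ hA0 hB0)
  change HasDerivAt (fun t => 1 - 2 * _ + 2 * _) d t at hd
  rw [h1] at hd
  exact nonneg_neg_of_hasDerivAt hd

/-- The variable `X` occurs alone in the random sum with the positive probability `α`, and so its
law inherits absolute continuity and the support from the switching time. -/
lemma IsRepresentation.map_absolutelyContinuous (h : IsRepresentation P Tp Tm α β Q X Y νa νb)
    (hα : 0 < α) (hβ : 0 < β) (hαβ : α + β = 1) : Q.map (X 0) ≪ P.map Tp := by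
  refine (Measure.absolutelyContinuous_smul (c := ENNReal.ofReal α) (by simpa using hα)).trans ?_
  rw [h.eq_add_conv hα hβ hαβ]
  exact (Measure.le_add_right le_rfl).absolutelyContinuous

lemma IsRepresentation.map_eq_withDensity (h : IsRepresentation P Tp Tm α β Q X Y νa νb)
    (hα : 0 < α) (hβ : 0 < β) (hαβ : α + β = 1) (hA0 : P.map Tp (Iic 0) = 0)
    (hB0 : P.map Tm (Iic 0) = 0) (hA : P.map Tp ≪ volume) (k : ℕ) :
    Q.map (X k) = (volume.restrict (Ioi (0 : ℝ))).withDensity fun t => ENNReal.ofReal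
      (-(1 / (2 * α)) * deriv (meanFunction (P.map Tp) (P.map Tm)) t) := by
  have : IsProbabilityMeasure (P.map Tp) :=
    Measure.isProbabilityMeasure_map h.plus.aemeasurable_fst
  have : IsProbabilityMeasure (P.map Tm) :=
    Measure.isProbabilityMeasure_map h.minus.aemeasurable_fst
  have : IsProbabilityMeasure (Q.map (X 0)) :=
    Measure.isProbabilityMeasure_map (h.measurable_X 0).aemeasurable
  have hac := h.map_absolutelyContinuous hα hβ hαβ
  rw [(h.identDistrib_X k).map_eq]
  exact eq_withDensity_of_eq_smul_add hα (evenRenewal_Iic_lt_top hA0 hB0)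
    (h.oddRenewal_eq hα hβ hαβ hA0 hB0) (hac.trans hA) (hac hA0)

end Consequences

lemma integral_pos_of_nonneg {Ω : Type*} [MeasurableSpace Ω] {P : Measure Ω}
    [IsProbabilityMeasure P] {T : Ω → ℝ} (hm : Measurable T) (h0 : ∀ᵐ ω ∂P, 0 ≤ T ω)
    (hT : P.map T (Iic 0) = 0) (hi : Integrable T P) : 0 < ∫ ω, T ω ∂P := by
  refine lt_of_le_of_ne (integral_nonneg_of_ae h0) fun h => ?_
  have h1 := (integral_eq_zero_iff_of_nonneg_ae h0 hi).1 h.symm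
  have h2 : ∀ᵐ ω ∂P, 0 < T ω := by
    rw [Measure.map_apply hm measurableSet_Iic] at hT
    rw [ae_iff]
    simp only [not_lt]
    exact hT
  obtain ⟨ω, h3, h4⟩ := (h1.and h2).exists
  exact h4.ne' h3

lemma lintegral_ofReal_map {Ω : Type*} [MeasurableSpace Ω] {P : Measure Ω} {T : Ω → ℝ}
    (hm : Measurable T) (h0 : ∀ᵐ ω ∂P, 0 ≤ T ω) (hi : Integrable T P) :
    ∫⁻ x, ENNReal.ofReal x ∂(P.map T) = ENNReal.ofReal (∫ ω, T ω ∂P) := by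
  rw [lintegral_map (by fun_prop) hm, ofReal_integral_eq_lintegral_ofReal hi h0]

end SwitchProcess

theorem theorem2 {Ω : Type*} [MeasurableSpace Ω] (P : Measure Ω) [IsProbabilityMeasure P]
    (δ : Ω → ℤ) (Tp Tm : ℕ → Ω → ℝ) (hD : IsSwitchData P δ Tp Tm)
    (hplus : 0 < P {ω | δ ω = 1}) (hminus : 0 < P {ω | δ ω = -1})
    (Ep Em : ℝ → ℝ)
    (hEp : Ep = expectedValue P δ Tp Tm 1) (hEm : Em = expectedValue P δ Tp Tm (-1))
    (μp μm α β : ℝ) (hμp : μp = ∫ ω, Tp 0 ω ∂P) (hμm : μm = ∫ ω, Tm 0 ω ∂P)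
    (hα : α = μm / (μp + μm)) (hβ : β = μp / (μp + μm)) :
    -- the derivatives of the expected value functions exist almost everywhere
    (∀ᵐ t ∂(volume.restrict (Ioi (0 : ℝ))), DifferentiableAt ℝ Ep t ∧ DifferentiableAt ℝ Em t) ∧
    -- the equivalence
    ((∀ t : ℝ, 0 < t →
        (∀ d : ℝ, HasDerivAt Ep d t → 0 ≤ -d) ∧ (∀ d : ℝ, HasDerivAt Em d t → 0 ≤ d)) ↔
      ∃ (Ω' : Type) (_ : MeasurableSpace Ω') (Q : Measure Ω') (_ : IsProbabilityMeasure Q)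
        (X Y : ℕ → Ω' → ℝ) (νa νb : Ω' → ℕ),
        IsRepresentation P (Tp 0) (Tm 0) α β Q X Y νa νb) ∧
    -- the densities of the variables in any such representation
    (∀ (Ω' : Type*) [MeasurableSpace Ω'] (Q : Measure Ω') [IsProbabilityMeasure Q]
        (X Y : ℕ → Ω' → ℝ) (νa νb : Ω' → ℕ),
        IsRepresentation P (Tp 0) (Tm 0) α β Q X Y νa νb → ∀ k : ℕ,
          Q.map (X k) = (volume.restrict (Ioi (0 : ℝ))).withDensity
            (fun t => ENNReal.ofReal (-(1 / (2 * α)) * deriv Ep t)) ∧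
          Q.map (Y k) = (volume.restrict (Ioi (0 : ℝ))).withDensity
            (fun t => ENNReal.ofReal (1 / (2 * β) * deriv Em t))) := by
  have hpm := hD.measurable_plus 0
  have hmm := hD.measurable_minus 0
  have hA0 := measure_Iic_zero_of_nonneg hpm hD.nonneg_plus hD.absolutelyContinuous_plus
  have hB0 := measure_Iic_zero_of_nonneg hmm hD.nonneg_minus hD.absolutelyContinuous_minus
  have hA := hD.absolutelyContinuous_plus
  have hB := hD.absolutelyContinuous_minus
  have : IsProbabilityMeasure (P.map (Tp 0)) := Measure.isProbabilityMeasure_map hpm.aemeasurable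
  have : IsProbabilityMeasure (P.map (Tm 0)) := Measure.isProbabilityMeasure_map hmm.aemeasurable
  have hμp0 : 0 < μp := hμp ▸ integral_pos_of_nonneg hpm hD.nonneg_plus hA0 hD.integrable_plus
  have hμm0 : 0 < μm := hμm ▸ integral_pos_of_nonneg hmm hD.nonneg_minus hB0 hD.integrable_minus
  have hα0 : 0 < α := by rw [hα]; positivity
  have hβ0 : 0 < β := by rw [hβ]; positivity
  have hαβ : α + β = 1 := by rw [hα, hβ]; field_simp; ring
  have hEp' : Ep = meanFunction (P.map (Tp 0)) (P.map (Tm 0)) :=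
    hEp.trans (funext (expectedValue_one hD hplus))
  have hminus' : 0 < P {ω | -δ ω = 1} := by
    rwa [show {ω | -δ ω = 1} = {ω | δ ω = -1} by ext ω; simp only [mem_ofPred_eq]; omega]
  have hEm' : Em = fun t => -meanFunction (P.map (Tm 0)) (P.map (Tp 0)) t := by
    rw [hEm]
    ext t
    rw [expectedValue_swap hD.sign_eq, expectedValue_one hD.swap hminus']
    rfl
  refine ⟨ae_restrict_of_ae ?_, ⟨fun h => ?_, ?_⟩, ?_⟩
  · filter_upwards [ae_differentiableAt_one_sub_add (oddRenewal_Iic_lt_top hA0 hB0)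
      (evenRenewal_Iic_lt_top hA0 hB0), ae_differentiableAt_one_sub_add
      (oddRenewal_Iic_lt_top hB0 hA0) (evenRenewal_Iic_lt_top hB0 hA0)] with t h1 h2
    rw [hEp', hEm']
    exact ⟨h1, h2.neg⟩
  · obtain ⟨ρ, _, hρ⟩ := exists_eq_add_of_meanFunction hA0 hB0 hA fun t ht d hd =>
      (h t ht).1 d (hEp' ▸ hd)
    obtain ⟨σ, _, hσ⟩ := exists_eq_add_of_meanFunction hB0 hA0 hB fun t ht d hd =>
      (h t ht).2 (-d) (hEm' ▸ hd.neg)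
    have hAeq := eq_add_conv_of_oddRenewal_eq hA0 hB0 hρ hσ
    have hBeq := eq_add_conv_of_oddRenewal_eq hB0 hA0 hσ hρ
    have hma := lintegral_ofReal_map hpm hD.nonneg_plus hD.integrable_plus
    have hmb := lintegral_ofReal_map hmm hD.nonneg_minus hD.integrable_minus
    rw [← hμp] at hma
    rw [← hμm] at hmb
    refine exists_isRepresentation hpm hmm hAeq hBeq hα0 hβ0 hαβ ?_ ?_
    · rw [hα]
      exact measure_univ_of_equations hA0 hB0 hAeq hBeq hμp0 hμm0 hma hmb
    · rw [hβ, add_comm μp]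
      exact measure_univ_of_equations hB0 hA0 hBeq hAeq hμm0 hμp0 hmb hma
  · rintro ⟨Ω', _, Q, _, X, Y, νa, νb, h⟩ t -
    refine ⟨fun d hd => ?_, fun d hd => ?_⟩
    · rw [hEp'] at hd
      exact h.nonneg_neg hα0 hβ0 hαβ hA0 hB0 hd
    · rw [hEm'] at hd
      have hd' := hd.neg
      simp only [Pi.neg_def, neg_neg] at hd'
      simpa using h.swap.nonneg_neg hβ0 hα0 (by rwa [add_comm]) hB0 hA0 hd'
  · intro Ω' _ Q _ X Y νa νb h k
    refine ⟨?_, ?_⟩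
    · rw [hEp']
      exact h.map_eq_withDensity hα0 hβ0 hαβ hA0 hB0 hA k
    · rw [h.swap.map_eq_withDensity hβ0 hα0 (by rwa [add_comm]) hB0 hA0 hB k, hEm']
      congr 1
      ext1 t
      rw [deriv.fun_neg]
      congr 1
      ring
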